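/- A point-line geometry consists of a set of points, a set of lines and an incidence relation between points and lines. It is a partial plane if any two distinct points are incident with at most one common line. It is a projective plane if any two distinct points are incident with a unique common line, any two distinct lines are incident with a unique common point, and there are four distinct points no three of which are incident with a common line. It is confined if it has finitely many points and lines, every line is incident with at least three points, and every point is incident with at least three lines. The automorphism group $\mathrm{Aut}(\Gamma)$ of a geometry $\Gamma$ consists of all pairs of a permutation of the points and a permutation of the lines which preserve incidence and non-incidence; $\Gamma$ is rigid if $\mathrm{Aut}(\Gamma)$ is trivial. The free completion $\overline{\mathcal{C}_0}$ of a partial plane $\mathcal{C}_0$ is $\bigcup_{i\in\mathbb{N}}\mathcal{C}_i$, where for even $i$ the geometry $\mathcal{C}_{i+1}$ arises from $\mathcal{C}_i$ by adding, for each pair of distinct lines of $\mathcal{C}_i$ without a common point, one new point incident with exactly these two lines, and for odd $i$ the geometry $\mathcal{C}_{i+1}$ arises from $\mathcal{C}_i$ by adding, for each pair of distinct points of $\mathcal{C}_i$ without a common line, one new line incident with exactly these two points. If $\mathcal{C}$ is a subconfiguration of $\Gamma$ (a set of points and a set of lines of $\Gamma$, with the inherited incidence), let $\Gamma\setminus\mathcal{C}$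 be the geometry of the points and lines of $\Gamma$ not in $\mathcal{C}$, with the inherited incidence. $\mathcal{C}$ is an automorphism-blocking set of $\Gamma$ if (AB1) every automorphism of $\Gamma\setminus\mathcal{C}$ extends to an automorphism of $\Gamma$; (AB2) the elementwise stabilizer $\mathrm{Aut}(\Gamma)_{[\mathcal{C}]}$ of $\mathcal{C}$ in $\mathrm{Aut}(\Gamma)$ is trivial; (AB3) the setwise stabilizer satisfies $\mathrm{Aut}(\Gamma)_{\mathcal{C}}=\mathrm{Aut}(\Gamma)_{[\mathcal{C}]}$. Theorem. (1) If $\mathcal{C}_0$ is a nonempty confined (in particular finite) partial plane which is rigid, then its free completion $\overline{\mathcal{C}_0}$ is a rigid projective plane. (2) If $\mathcal{C}$ is an automorphism-blocking set of a point-line geometry $\Gamma$ such that $\Gamma\setminus\mathcal{C}$ is a nonempty confined partial plane, then the free completion $\overline{\Gamma\setminus\mathcal{C}}$ is a rigid projective plane. -/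

import Mathlib

universe u

/-- A point-line geometry (point-line incidence structure): points, lines, and an incidence
relation between them. -/
structure PointLineGeometry where
  Point : Type u
  Line : Type u
  Inc : Point → Line → Prop

namespace PointLineGeometry

/-- The geometry does not violate the axioms of a projective plane: two distinct points lie on at
most one common line (equivalently, two distinct lines share at most one point). -/
def IsPartialPlane (G : PointLineGeometry.{u}) : Prop :=
  ∀ (p q : G.Point) (l m : G.Line),
    G.Inc p l → G.Inc q l → G.Inc p m → G.Inc q m → p = q ∨ l = m

/-- Axiomatic projective planes: two distinct points are on a unique line, two distinct lines meet
in a unique point, and there are four distinct points no three of which are on a line. -/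
structure IsProjectivePlane (G : PointLineGeometry.{u}) : Prop where
  existsUnique_line : ∀ p q : G.Point, p ≠ q → ∃! l : G.Line, G.Inc p l ∧ G.Inc q l
  existsUnique_point : ∀ l m : G.Line, l ≠ m → ∃! p : G.Point, G.Inc p l ∧ G.Inc p m
  exists_quadrangle : ∃ x : Fin 4 → G.Point, Function.Injective x ∧
    ∀ i j k : Fin 4, i ≠ j → i ≠ k → j ≠ k →
      ¬ ∃ l : G.Line, G.Inc (x i) l ∧ G.Inc (x j) l ∧ G.Inc (x k) l

/-- Confined configurations: finite, with at least three points on every line and at least three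
lines through every point. -/
structure IsConfined (G : PointLineGeometry.{u}) : Prop where
  finite_point : Finite G.Point
  finite_line : Finite G.Line
  three_le_lines : ∀ p : G.Point, 3 ≤ {l : G.Line | G.Inc p l}.encard
  three_le_points : ∀ l : G.Line, 3 ≤ {p : G.Point | G.Inc p l}.encard

/-- The automorphism group: pairs consisting of a permutation of the points and a permutation of
the lines which preserve incidence in both directions. -/
def Aut (G : PointLineGeometry.{u}) : Subgroup (Equiv.Perm G.Point × Equiv.Perm G.Line) where
  carrier := {a | ∀ p l, G.Inc (a.1 p) (a.2 l) ↔ G.Inc p l}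
  one_mem' := fun _ _ => Iff.rfl
  mul_mem' := fun {a b} ha hb p l => (ha (b.1 p) (b.2 l)).trans (hb p l)
  inv_mem' := fun {a} ha p l => by
    have h := ha (a.1⁻¹ p) (a.2⁻¹ l)
    simpa using h.symm

/-- A geometry is rigid if its automorphism group is trivial. -/
def IsRigid (G : PointLineGeometry.{u}) : Prop := G.Aut = ⊥

/-! ### Subconfigurations and automorphism-blocking sets -/

/-- A subconfiguration: a set of points and a set of lines, with the inherited incidence. -/
structure Subconfig (G : PointLineGeometry.{u}) where
  points : Set G.Point
  lines : Set G.Line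

/-- The geometry left after removing the points and the lines of a subconfiguration. -/
def delete (G : PointLineGeometry.{u}) (C : G.Subconfig) : PointLineGeometry.{u} where
  Point := {p : G.Point // p ∉ C.points}
  Line := {l : G.Line // l ∉ C.lines}
  Inc p l := G.Inc p.1 l.1

/-- The setwise stabilizer of a subconfiguration in the automorphism group. -/
def stabilizer (G : PointLineGeometry.{u}) (C : G.Subconfig) :
    Subgroup (Equiv.Perm G.Point × Equiv.Perm G.Line) where
  carrier := {a | a ∈ G.Aut ∧ (∀ p, a.1 p ∈ C.points ↔ p ∈ C.points) ∧
    ∀ l, a.2 l ∈ C.lines ↔ l ∈ C.lines}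
  one_mem' := ⟨G.Aut.one_mem, fun _ => Iff.rfl, fun _ => Iff.rfl⟩
  mul_mem' := fun {a b} ha hb => ⟨G.Aut.mul_mem ha.1 hb.1,
    fun p => (ha.2.1 (b.1 p)).trans (hb.2.1 p), fun l => (ha.2.2 (b.2 l)).trans (hb.2.2 l)⟩
  inv_mem' := fun {a} ha => ⟨G.Aut.inv_mem ha.1,
    fun p => by simpa using (ha.2.1 (a.1⁻¹ p)).symm,
    fun l => by simpa using (ha.2.2 (a.2⁻¹ l)).symm⟩

/-- The elementwise stabilizer of a subconfiguration in the automorphism group. -/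
def elementwiseStabilizer (G : PointLineGeometry.{u}) (C : G.Subconfig) :
    Subgroup (Equiv.Perm G.Point × Equiv.Perm G.Line) where
  carrier := {a | a ∈ G.Aut ∧ (∀ p ∈ C.points, a.1 p = p) ∧ ∀ l ∈ C.lines, a.2 l = l}
  one_mem' := ⟨G.Aut.one_mem, fun _ _ => rfl, fun _ _ => rfl⟩
  mul_mem' := fun {a b} ha hb => ⟨G.Aut.mul_mem ha.1 hb.1,
    fun p hp => by simp [hb.2.1 p hp, ha.2.1 p hp],
    fun l hl => by simp [hb.2.2 l hl, ha.2.2 l hl]⟩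
  inv_mem' := fun {a} ha => ⟨G.Aut.inv_mem ha.1,
    fun p hp => Equiv.Perm.inv_eq_iff_eq.2 (ha.2.1 p hp).symm,
    fun l hl => Equiv.Perm.inv_eq_iff_eq.2 (ha.2.2 l hl).symm⟩

/-- Automorphism-blocking sets (AB-sets) of a geometry. -/
structure IsABSet (G : PointLineGeometry.{u}) (C : G.Subconfig) : Prop where
  /-- (AB1) Every automorphism of the complement extends to an automorphism of the geometry. -/
  ab1 : ∀ b ∈ (G.delete C).Aut, ∃ a ∈ G.Aut,
    (∀ p : (G.delete C).Point, a.1 p.1 = (b.1 p).1) ∧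
    ∀ l : (G.delete C).Line, a.2 l.1 = (b.2 l).1
  /-- (AB2) The elementwise stabilizer is trivial. -/
  ab2 : G.elementwiseStabilizer C = ⊥
  /-- (AB3) The setwise stabilizer is the elementwise stabilizer. -/
  ab3 : G.stabilizer C = G.elementwiseStabilizer C

/-! ### The free completion -/

/-- Unordered pairs of distinct lines which have no point in common. -/
def NonconcurrentPair (G : PointLineGeometry.{u}) : Type u :=
  {s : Sym2 G.Line // ¬ s.IsDiag ∧ ¬ ∃ p : G.Point, ∀ l ∈ s, G.Inc p l}

/-- Unordered pairs of distinct points which have no line in common. -/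
def NoncollinearPair (G : PointLineGeometry.{u}) : Type u :=
  {s : Sym2 G.Point // ¬ s.IsDiag ∧ ¬ ∃ l : G.Line, ∀ p ∈ s, G.Inc p l}

/-- Add, for every nonconcurrent pair of lines, one new point incident with exactly the two lines
of that pair. -/
def addPoints (G : PointLineGeometry.{u}) : PointLineGeometry.{u} where
  Point := G.Point ⊕ G.NonconcurrentPair
  Line := G.Line
  Inc x l := Sum.elim (fun p => G.Inc p l) (fun s => l ∈ s.1) x

/-- Add, for every noncollinear pair of points, one new line incident with exactly the two points
of that pair. -/
def addLines (G : PointLineGeometry.{u}) : PointLineGeometry.{u} where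
  Point := G.Point
  Line := G.Line ⊕ G.NoncollinearPair
  Inc p x := Sum.elim (fun l => G.Inc p l) (fun s => p ∈ s.1) x

/-- The stages of the free construction. Passing from a stage to the next one performs two steps:
first add the missing intersection points, then add the missing connecting lines. -/
def stage (G : PointLineGeometry.{u}) : ℕ → PointLineGeometry.{u}
  | 0 => G
  | n + 1 => (stage G n).addPoints.addLines

/-- The inclusion of the points of a stage in those of the next stage. -/
def stagePoint (G : PointLineGeometry.{u}) (n : ℕ) (p : (G.stage n).Point) :
    (G.stage (n + 1)).Point :=
  (Sum.inl p : (G.stage n).Point ⊕ (G.stage n).NonconcurrentPair)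

/-- The inclusion of the lines of a stage in those of the next stage. -/
def stageLine (G : PointLineGeometry.{u}) (n : ℕ) (l : (G.stage n).Line) :
    (G.stage (n + 1)).Line :=
  (Sum.inl l : (G.stage n).Line ⊕ (G.stage n).addPoints.NoncollinearPair)

/-- The points of the union of all stages: an element of a stage is identified with its image in
the next stage. -/
def UnionPoint (G : PointLineGeometry.{u}) : Type u :=
  Quot fun x y : (Σ n, (G.stage n).Point) => y = ⟨x.1 + 1, G.stagePoint x.1 x.2⟩

/-- The lines of the union of all stages. -/
def UnionLine (G : PointLineGeometry.{u}) : Type u :=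
  Quot fun x y : (Σ n, (G.stage n).Line) => y = ⟨x.1 + 1, G.stageLine x.1 x.2⟩

/-- The free completion: the union of all stages of the free construction. A point and a line are
incident if they are incident in some stage. -/
def freeCompletion (G : PointLineGeometry.{u}) : PointLineGeometry.{u} where
  Point := G.UnionPoint
  Line := G.UnionLine
  Inc x y := ∃ (n : ℕ) (p : (G.stage n).Point) (l : (G.stage n).Line),
    x = Quot.mk _ ⟨n, p⟩ ∧ y = Quot.mk _ ⟨n, l⟩ ∧ (G.stage n).Inc p l

/-- Agreement with Mathlib's projective planes. -/
theorem isProjectivePlane_iff_mathlib (G : PointLineGeometry.{u}) : G.IsProjectivePlane ↔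
    Nonempty (@Configuration.ProjectivePlane G.Point G.Line ⟨fun l p => G.Inc p l⟩) := by
  let _ : Membership G.Point G.Line := ⟨fun l p => G.Inc p l⟩
  constructor
  · rintro ⟨ha, hb, x, hx, hq⟩
    have h01 : x 0 ≠ x 1 := fun h => by simpa using hx h
    have h02 : x 0 ≠ x 2 := fun h => by simpa using hx h
    have h03 : x 0 ≠ x 3 := fun h => by simpa using hx h
    have h12 : x 1 ≠ x 2 := fun h => by simpa using hx h
    have h13 : x 1 ≠ x 3 := fun h => by simpa using hx h
    have q012 := hq 0 1 2 (by decide) (by decide) (by decide)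
    have q013 := hq 0 1 3 (by decide) (by decide) (by decide)
    have q023 := hq 0 2 3 (by decide) (by decide) (by decide)
    have q123 := hq 1 2 3 (by decide) (by decide) (by decide)
    obtain ⟨l1, hl1, -⟩ := ha _ _ h03
    obtain ⟨l2, hl2, -⟩ := ha _ _ h12
    obtain ⟨l3, hl3, -⟩ := ha _ _ h13
    obtain ⟨l4, hl4, -⟩ := ha _ _ h01
    obtain ⟨l5, hl5, -⟩ := ha _ _ h02
    refine ⟨{
      exists_point := ?_
      exists_line := ?_
      eq_or_eq := ?_
      mkPoint := fun {l m} h => (hb l m h).choose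
      mkPoint_ax := fun {l m} h => (hb l m h).choose_spec.1
      mkLine := fun {p q} h => (ha p q h).choose
      mkLine_ax := fun {p q} h => (ha p q h).choose_spec.1
      exists_config := ⟨x 0, x 1, x 2, l1, l2, l3, ?_⟩ }⟩
    · intro l
      by_contra! h
      exact q012 ⟨l, h _, h _, h _⟩
    · intro p
      by_contra! h
      have e1 : p = x 1 := (hb l4 l2 (fun e => q012 ⟨l2, e ▸ hl4.1, hl2.1, hl2.2⟩)).unique
        ⟨h _, h _⟩ ⟨hl4.2, hl2.1⟩
      exact q012 ⟨l5, hl5.1, e1 ▸ h l5, hl5.2⟩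
    · intro p q l m h1 h2 h3 h4
      by_contra! h
      exact h.2 ((ha p q h.1).unique ⟨h1, h2⟩ ⟨h3, h4⟩)
    · exact ⟨fun h => q012 ⟨l2, h, hl2.1, hl2.2⟩, fun h => q013 ⟨l3, h, hl3.1, hl3.2⟩,
        fun h => q013 ⟨l1, hl1.1, h, hl1.2⟩, hl2.1, hl3.1,
        fun h => q023 ⟨l1, hl1.1, h, hl1.2⟩, hl2.2, fun h => q123 ⟨l3, hl3.1, h, hl3.2⟩⟩
  · rintro ⟨inst⟩
    have ha : ∀ p q : G.Point, p ≠ q → ∃! l : G.Line, G.Inc p l ∧ G.Inc q l :=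
      Configuration.HasLines.existsUnique_line G.Point G.Line
    have hb : ∀ l m : G.Line, l ≠ m → ∃! p : G.Point, G.Inc p l ∧ G.Inc p m :=
      Configuration.HasPoints.existsUnique_point G.Point G.Line
    have hu : ∀ {p q : G.Point} {l m : G.Line},
      G.Inc p l → G.Inc q l → G.Inc p m → G.Inc q m → p = q ∨ l = m :=
      Configuration.Nondegenerate.eq_or_eq (P := G.Point) (L := G.Line)
    obtain ⟨p1, p2, p3, l1, l2, l3, h⟩ :=
      Configuration.ProjectivePlane.exists_config (P := G.Point) (L := G.Line)
    obtain ⟨h12, h13, h21, h22, h23, h31, h32, h33⟩ : ¬ G.Inc p1 l2 ∧ ¬ G.Inc p1 l3 ∧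
      ¬ G.Inc p2 l1 ∧ G.Inc p2 l2 ∧ G.Inc p2 l3 ∧ ¬ G.Inc p3 l1 ∧ G.Inc p3 l2 ∧ ¬ G.Inc p3 l3 := h
    refine ⟨ha, hb, ?_⟩
    have key : ∀ a b c d : G.Point,
        (¬ ∃ l, G.Inc a l ∧ G.Inc b l ∧ G.Inc c l) → (¬ ∃ l, G.Inc a l ∧ G.Inc b l ∧ G.Inc d l) →
        (¬ ∃ l, G.Inc a l ∧ G.Inc c l ∧ G.Inc d l) → (¬ ∃ l, G.Inc b l ∧ G.Inc c l ∧ G.Inc d l) →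
        ∃ x : Fin 4 → G.Point, Function.Injective x ∧
          ∀ i j k : Fin 4, i ≠ j → i ≠ k → j ≠ k →
            ¬ ∃ l : G.Line, G.Inc (x i) l ∧ G.Inc (x j) l ∧ G.Inc (x k) l := by
      intro a b c d e1 e2 e3 e4
      have join : ∀ p q : G.Point, ∃ l, G.Inc p l ∧ G.Inc q l := by
        intro p q
        by_cases hpq : p = q
        · subst hpq
          by_cases hp : p = p1
          · obtain ⟨l, hl, -⟩ := ha p p2 (by rintro rfl; subst hp; exact h12 h22)
            exact ⟨l, hl.1, hl.1⟩
          · obtain ⟨l, hl, -⟩ := ha p p1 hp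
            exact ⟨l, hl.1, hl.1⟩
        · obtain ⟨l, hl, -⟩ := ha p q hpq
          exact ⟨l, hl⟩
      have n1 : a ≠ b := by
        rintro rfl
        obtain ⟨l, hl⟩ := join a c
        exact e1 ⟨l, hl.1, hl⟩
      have n2 : a ≠ c := by
        rintro rfl
        obtain ⟨l, hl⟩ := join a b
        exact e1 ⟨l, hl.1, hl.2, hl.1⟩
      have n3 : a ≠ d := by
        rintro rfl
        obtain ⟨l, hl⟩ := join a b
        exact e2 ⟨l, hl.1, hl.2, hl.1⟩
      have n4 : b ≠ c := by
        rintro rfl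
        obtain ⟨l, hl⟩ := join a b
        exact e1 ⟨l, hl.1, hl.2, hl.2⟩
      have n5 : b ≠ d := by
        rintro rfl
        obtain ⟨l, hl⟩ := join a b
        exact e2 ⟨l, hl.1, hl.2, hl.2⟩
      have n6 : c ≠ d := by
        rintro rfl
        obtain ⟨l, hl⟩ := join a c
        exact e3 ⟨l, hl.1, hl.2, hl.2⟩
      clear ha hb hu join h12 h13 h21 h22 h23 h31 h32 h33
      refine ⟨![a, b, c, d], ?_, ?_⟩
      · intro i j hij
        fin_cases i <;> fin_cases j <;> simp at hij ⊢ <;> grind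
      · intro i j k hij hik hjk
        fin_cases i <;> fin_cases j <;> fin_cases k <;> simp at hij hik hjk ⊢ <;> grind
    obtain ⟨m, hm, -⟩ := ha p1 p3 (by rintro rfl; exact h12 h32)
    obtain ⟨x, hx, -⟩ := hb l3 l1 (by rintro rfl; exact h21 h23)
    obtain ⟨y, hy, -⟩ := hb l1 l2 (by rintro rfl; exact h21 h22)
    by_cases hxm : G.Inc x m
    · refine key p1 p2 x y ?_ ?_ ?_ ?_ <;> rintro ⟨l, hl⟩ <;> grind
    · refine key p1 p2 p3 x ?_ ?_ ?_ ?_ <;> rintro ⟨l, hl⟩ <;> grind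

end PointLineGeometry

/-!
Let `C₀` be a nonempty confined partial plane.

Each step of the free construction keeps the geometry a partial plane, and it embeds each stage into
the next one with the same incidence, so the stages embed into the free completion. Two lines of a
stage meet at the latest in the next stage, and two points are joined at the latest in the next
stage; hence the completion satisfies the two incidence axioms. Two points different from `p` on
each of two lines through a point `p` of `C₀` form a quadrangle.

For rigidity, call a set `P` of points and a set `L` of lines *thick* if every line of `L` is
incident with at least three points of `P` and vice versa. An element that is new in a stage is
incident with only two elements present when it is added. Therefore a thick pair lying in stage
`n + 1` already lies in stage `n`, and finally in `C₀` (`IsThick.subset_zero`). The image of `C₀`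
under an automorphism of the completion is thick and finite, so it lies in some stage, hence in
`C₀`. Thus every automorphism restricts to `C₀`, where it is trivial by rigidity. Since every new
element is determined by the two elements it was added for, the automorphism is trivial on every
stage (`eq_of_fixes_zero`).

For an automorphism-blocking set, (AB1) extends an automorphism of the complement to the whole
geometry; the extension stabilizes the blocking set setwise, so by (AB2) and (AB3) it is trivial.
Hence the complement is rigid and the first part applies.
-/

/-! ### Unions of sequences of types -/

/-- The union (sequential colimit) of a sequence of types along transition maps, in the form used
for the points and the lines of a free completion. -/
abbrev SeqUnion {X : ℕ → Type u} (f : ∀ n, X n → X (n + 1)) : Type u :=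
  Quot fun x y : (Σ n, X n) => y = ⟨x.1 + 1, f x.1 x.2⟩

namespace SeqUnion

variable {X : ℕ → Type u} (f : ∀ n, X n → X (n + 1))

/-- The map of the `n`-th type of the sequence to the union. -/
def of (n : ℕ) (x : X n) : SeqUnion f := Quot.mk _ ⟨n, x⟩

theorem of_succ (n : ℕ) (x : X n) : of f (n + 1) (f n x) = of f n x :=
  (Quot.sound (r := fun x y : (Σ n, X n) => y = ⟨x.1 + 1, f x.1 x.2⟩) (a := ⟨n, x⟩) rfl).symm

theorem exists_of_eq (x : SeqUnion f) : ∃ n a, of f n a = x := by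
  obtain ⟨n, a⟩ := x
  exact ⟨n, a, rfl⟩

theorem range_of_mono : Monotone fun n => Set.range (of f n) :=
  monotone_nat_of_le_succ fun n => by
    rintro _ ⟨a, rfl⟩
    exact ⟨f n a, of_succ f n a⟩

theorem exists_leRecOn_eq {x y : Σ n, X n}
    (h : (Quot.mk _ x : SeqUnion f) = Quot.mk _ y) :
    ∃ (m : ℕ) (hx : x.1 ≤ m) (hy : y.1 ≤ m),
      Nat.leRecOn (C := X) hx (fun {k} => f k) x.2 =
        Nat.leRecOn (C := X) hy (fun {k} => f k) y.2 := by
  have h' := Quot.eqvGen_exact h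
  clear h
  induction h' with
  | rel x y h =>
    subst h
    refine ⟨x.1 + 1, Nat.le_succ _, le_rfl, ?_⟩
    rw [Nat.leRecOn_self, Nat.leRecOn_succ']
  | refl x => exact ⟨x.1, le_rfl, le_rfl, rfl⟩
  | symm x y _ ih =>
    obtain ⟨m, hx, hy, e⟩ := ih
    exact ⟨m, hy, hx, e.symm⟩
  | trans x y z _ _ ih₁ ih₂ =>
    obtain ⟨m, hx, hy, e⟩ := ih₁
    obtain ⟨m', hy', hz, e'⟩ := ih₂
    refine ⟨max m m', hx.trans (le_max_left _ _), hz.trans (le_max_right _ _), ?_⟩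
    rw [Nat.leRecOn_trans hx (le_max_left m m'), e, Nat.leRecOn_trans hz (le_max_right m m'), ← e',
      ← Nat.leRecOn_trans, ← Nat.leRecOn_trans]

variable {f}

theorem of_injective (hf : ∀ n, Function.Injective (f n)) (n : ℕ) :
    Function.Injective (of f n) := by
  intro a b h
  obtain ⟨m, hx, _, e⟩ := exists_leRecOn_eq f h
  exact Nat.leRecOn_injective hx (fun {k} => f k) hf e

end SeqUnion

namespace PointLineGeometry

variable {G : PointLineGeometry.{u}}

/-! ### The stages of the free construction -/

theorem IsPartialPlane.addPoints (h : G.IsPartialPlane) : G.addPoints.IsPartialPlane := by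
  rintro (p | s) (q | t) l m hpl hql hpm hqm
  · exact (h p q l m hpl hql hpm hqm).imp (congrArg Sum.inl) id
  · refine or_iff_not_imp_right.2 fun hlm => (t.2.2 ⟨p, ?_⟩).elim
    rw [(Sym2.mem_and_mem_iff hlm).1 ⟨hql, hqm⟩]
    exact Sym2.ball.2 ⟨hpl, hpm⟩
  · refine or_iff_not_imp_right.2 fun hlm => (s.2.2 ⟨q, ?_⟩).elim
    rw [(Sym2.mem_and_mem_iff hlm).1 ⟨hpl, hpm⟩]
    exact Sym2.ball.2 ⟨hql, hqm⟩
  · refine or_iff_not_imp_right.2 fun hlm => congrArg Sum.inr (Subtype.ext ?_)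
    rw [(Sym2.mem_and_mem_iff hlm).1 ⟨hpl, hpm⟩, (Sym2.mem_and_mem_iff hlm).1 ⟨hql, hqm⟩]

theorem IsPartialPlane.addLines (h : G.IsPartialPlane) : G.addLines.IsPartialPlane := by
  rintro p q (l | s) (m | t) hpl hql hpm hqm
  · exact (h p q l m hpl hql hpm hqm).imp id (congrArg Sum.inl)
  · refine or_iff_not_imp_left.2 fun hpq => (t.2.2 ⟨l, ?_⟩).elim
    rw [(Sym2.mem_and_mem_iff hpq).1 ⟨hpm, hqm⟩]
    exact Sym2.ball.2 ⟨hpl, hql⟩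
  · refine or_iff_not_imp_left.2 fun hpq => (s.2.2 ⟨m, ?_⟩).elim
    rw [(Sym2.mem_and_mem_iff hpq).1 ⟨hpl, hql⟩]
    exact Sym2.ball.2 ⟨hpm, hqm⟩
  · refine or_iff_not_imp_left.2 fun hpq => congrArg Sum.inr (Subtype.ext ?_)
    rw [(Sym2.mem_and_mem_iff hpq).1 ⟨hpl, hql⟩, (Sym2.mem_and_mem_iff hpq).1 ⟨hpm, hqm⟩]

theorem IsPartialPlane.stage (h : G.IsPartialPlane) : ∀ n, (G.stage n).IsPartialPlane
  | 0 => h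
  | n + 1 => (IsPartialPlane.stage h n).addPoints.addLines

theorem stagePoint_injective (n : ℕ) : Function.Injective (G.stagePoint n) :=
  fun _ _ h => Sum.inl_injective h

theorem stageLine_injective (n : ℕ) : Function.Injective (G.stageLine n) :=
  fun _ _ h => Sum.inl_injective h

theorem exists_stage_line {n : ℕ} {p q : (G.stage n).Point} (h : p ≠ q) :
    ∃ l, (G.stage (n + 1)).Inc (G.stagePoint n p) l ∧
      (G.stage (n + 1)).Inc (G.stagePoint n q) l := by
  by_cases hl : ∃ l, ∀ r ∈ s(G.stagePoint n p, G.stagePoint n q), (G.stage n).addPoints.Inc r l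
  · obtain ⟨l, hl⟩ := hl
    exact ⟨Sum.inl l, Sym2.ball.1 hl⟩
  · exact ⟨Sum.inr ⟨s(G.stagePoint n p, G.stagePoint n q),
      fun e => h (stagePoint_injective n (Sym2.mk_isDiag_iff.1 e)), hl⟩,
      Sym2.mem_mk_left _ _, Sym2.mem_mk_right _ _⟩

theorem exists_stage_point {n : ℕ} {l m : (G.stage n).Line} (h : l ≠ m) :
    ∃ p, (G.stage (n + 1)).Inc p (G.stageLine n l) ∧
      (G.stage (n + 1)).Inc p (G.stageLine n m) := by
  by_cases hp : ∃ p, ∀ k ∈ s(l, m), (G.stage n).Inc p k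
  · obtain ⟨p, hp⟩ := hp
    exact ⟨Sum.inl p, (Sym2.ball (p := (G.stage n).Inc p)).1 hp⟩
  · exact ⟨Sum.inr ⟨s(l, m), fun e => h (Sym2.mk_isDiag_iff.1 e), hp⟩,
      Sym2.mem_mk_left _ _, Sym2.mem_mk_right _ _⟩

/-- A point of stage `n + 1` that is not in stage `n` is on exactly two lines of stage `n`. -/
theorem exists_stage_point_cases (n : ℕ) (p : (G.stage (n + 1)).Point) :
    p ∈ Set.range (G.stagePoint n) ∨ ∃ a b, a ≠ b ∧
      ∀ l, (G.stage (n + 1)).Inc p (G.stageLine n l) ↔ l = a ∨ l = b := by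
  obtain p | ⟨s, hs, -⟩ := p
  · exact Or.inl ⟨p, rfl⟩
  · induction s with
    | _ a b => exact Or.inr ⟨a, b, fun e => hs (Sym2.mk_isDiag_iff.2 e), fun l => Sym2.mem_iff⟩

/-- A line of stage `n + 1` that is not in stage `n` contains exactly two points of
stage `n + 1`. -/
theorem exists_stage_line_cases (n : ℕ) (l : (G.stage (n + 1)).Line) :
    l ∈ Set.range (G.stageLine n) ∨ ∃ a b, a ≠ b ∧
      ∀ p, (G.stage (n + 1)).Inc p l ↔ p = a ∨ p = b := by
  obtain l | ⟨s, hs, -⟩ := l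
  · exact Or.inl ⟨l, rfl⟩
  · induction s with
    | _ a b => exact Or.inr ⟨a, b, fun e => hs (Sym2.mk_isDiag_iff.2 e), fun p => Sym2.mem_iff⟩

/-! ### The embedding of the stages into the free completion -/

/-- The map of the points of a stage to the points of the free completion. -/
def ofPoint (G : PointLineGeometry.{u}) (n : ℕ) : (G.stage n).Point → G.freeCompletion.Point :=
  SeqUnion.of G.stagePoint n

/-- The map of the lines of a stage to the lines of the free completion. -/
def ofLine (G : PointLineGeometry.{u}) (n : ℕ) : (G.stage n).Line → G.freeCompletion.Line :=
  SeqUnion.of G.stageLine n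

theorem ofPoint_stagePoint (n : ℕ) (p : (G.stage n).Point) :
    G.ofPoint (n + 1) (G.stagePoint n p) = G.ofPoint n p :=
  SeqUnion.of_succ G.stagePoint n p

theorem ofLine_stageLine (n : ℕ) (l : (G.stage n).Line) :
    G.ofLine (n + 1) (G.stageLine n l) = G.ofLine n l :=
  SeqUnion.of_succ G.stageLine n l

theorem ofPoint_injective (n : ℕ) : Function.Injective (G.ofPoint n) :=
  SeqUnion.of_injective stagePoint_injective n

theorem ofLine_injective (n : ℕ) : Function.Injective (G.ofLine n) :=
  SeqUnion.of_injective stageLine_injective n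

theorem range_ofPoint_mono : Monotone fun n => Set.range (G.ofPoint n) :=
  SeqUnion.range_of_mono G.stagePoint

theorem range_ofLine_mono : Monotone fun n => Set.range (G.ofLine n) :=
  SeqUnion.range_of_mono G.stageLine

theorem exists_mem_range_ofPoint (p : G.freeCompletion.Point) : ∃ n, p ∈ Set.range (G.ofPoint n) :=
  SeqUnion.exists_of_eq _ p

theorem exists_mem_range_ofLine (l : G.freeCompletion.Line) : ∃ n, l ∈ Set.range (G.ofLine n) :=
  SeqUnion.exists_of_eq _ l

theorem exists_forall_mem_range_ofPoint {ι : Type*} [Finite ι] (x : ι → G.freeCompletion.Point) :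
    ∃ n, ∀ i, x i ∈ Set.range (G.ofPoint n) := by
  choose k hk using fun i => exists_mem_range_ofPoint (x i)
  obtain ⟨n, hn⟩ := (Set.finite_range k).bddAbove
  exact ⟨n, fun i => range_ofPoint_mono (hn ⟨i, rfl⟩) (hk i)⟩

theorem exists_forall_mem_range_ofLine {ι : Type*} [Finite ι] (x : ι → G.freeCompletion.Line) :
    ∃ n, ∀ i, x i ∈ Set.range (G.ofLine n) := by
  choose k hk using fun i => exists_mem_range_ofLine (x i)
  obtain ⟨n, hn⟩ := (Set.finite_range k).bddAbove
  exact ⟨n, fun i => range_ofLine_mono (hn ⟨i, rfl⟩) (hk i)⟩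

/-- Incidence is unchanged from stage `n` on, whatever later stage is used to test it. -/
theorem inc_iff_inc_of_le {n m : ℕ} (hnm : n ≤ m) {p : (G.stage n).Point} {l : (G.stage n).Line}
    {p' : (G.stage m).Point} {l' : (G.stage m).Line} (hp : G.ofPoint m p' = G.ofPoint n p)
    (hl : G.ofLine m l' = G.ofLine n l) : (G.stage m).Inc p' l' ↔ (G.stage n).Inc p l := by
  induction m, hnm using Nat.le_induction with
  | base => rw [ofPoint_injective n hp, ofLine_injective n hl]
  | succ m hnm ih =>
    obtain ⟨p'', hp''⟩ := range_ofPoint_mono hnm ⟨p, rfl⟩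
    obtain ⟨l'', hl''⟩ := range_ofLine_mono hnm ⟨l, rfl⟩
    have e₁ : p' = G.stagePoint m p'' :=
      ofPoint_injective _ (by rw [hp, ofPoint_stagePoint, hp''])
    have e₂ : l' = G.stageLine m l'' :=
      ofLine_injective _ (by rw [hl, ofLine_stageLine, hl''])
    subst e₁ e₂
    exact ih hp'' hl''

theorem inc_of_iff {n : ℕ} {p : (G.stage n).Point} {l : (G.stage n).Line} :
    G.freeCompletion.Inc (G.ofPoint n p) (G.ofLine n l) ↔ (G.stage n).Inc p l := by
  refine ⟨?_, fun h => ⟨n, p, l, rfl, rfl, h⟩⟩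
  rintro ⟨m, p', l', hp, hl, h⟩
  obtain hnm | hmn := le_total n m
  · exact (inc_iff_inc_of_le hnm hp.symm hl.symm).1 h
  · exact (inc_iff_inc_of_le hmn hp hl).2 h

theorem IsPartialPlane.freeCompletion (h : G.IsPartialPlane) :
    G.freeCompletion.IsPartialPlane := by
  intro p q l m hpl hql hpm hqm
  obtain ⟨n₁, h₁⟩ := exists_forall_mem_range_ofPoint ![p, q]
  obtain ⟨n₂, h₂⟩ := exists_forall_mem_range_ofLine ![l, m]
  obtain ⟨p, rfl⟩ := range_ofPoint_mono (le_max_left n₁ n₂) (h₁ 0)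
  obtain ⟨q, rfl⟩ := range_ofPoint_mono (le_max_left n₁ n₂) (h₁ 1)
  obtain ⟨l, rfl⟩ := range_ofLine_mono (le_max_right n₁ n₂) (h₂ 0)
  obtain ⟨m, rfl⟩ := range_ofLine_mono (le_max_right n₁ n₂) (h₂ 1)
  exact (h.stage _ p q l m (inc_of_iff.1 hpl) (inc_of_iff.1 hql) (inc_of_iff.1 hpm)
    (inc_of_iff.1 hqm)).imp (congrArg _) (congrArg _)

/-! ### The free completion is a projective plane -/

theorem exists_mem_ne_ne {α : Type*} {s : Set α} (h : 3 ≤ s.encard) (a b : α) :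
    ∃ c ∈ s, c ≠ a ∧ c ≠ b := by
  by_contra! hc
  have hs : s ⊆ {a, b} := fun c hcs => or_iff_not_imp_left.2 (hc c hcs)
  have h2 : ({a, b} : Set α).encard ≤ 1 + 1 := by
    simpa using Set.encard_insert_le {b} a
  exact absurd (h.trans ((Set.encard_le_encard hs).trans h2)) (by decide)

theorem exists_line (p q : G.freeCompletion.Point) (h : p ≠ q) :
    ∃ l, G.freeCompletion.Inc p l ∧ G.freeCompletion.Inc q l := by
  obtain ⟨n, hn⟩ := exists_forall_mem_range_ofPoint ![p, q]
  obtain ⟨p, rfl⟩ := hn 0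
  obtain ⟨q, rfl⟩ := hn 1
  obtain ⟨l, hp, hq⟩ := exists_stage_line (n := n) fun e : p = q => h (congrArg _ e)
  refine ⟨G.ofLine (n + 1) l, ?_, ?_⟩
  · simpa [ofPoint_stagePoint] using inc_of_iff.2 hp
  · simpa [ofPoint_stagePoint] using inc_of_iff.2 hq

theorem exists_point (l m : G.freeCompletion.Line) (h : l ≠ m) :
    ∃ p, G.freeCompletion.Inc p l ∧ G.freeCompletion.Inc p m := by
  obtain ⟨n, hn⟩ := exists_forall_mem_range_ofLine ![l, m]
  obtain ⟨l, rfl⟩ := hn 0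
  obtain ⟨m, rfl⟩ := hn 1
  obtain ⟨p, hl, hm⟩ := exists_stage_point (n := n) fun e : l = m => h (congrArg _ e)
  refine ⟨G.ofPoint (n + 1) p, ?_, ?_⟩
  · simpa [ofLine_stageLine] using inc_of_iff.2 hl
  · simpa [ofLine_stageLine] using inc_of_iff.2 hm

/-- In a partial plane, two further points on each of two lines through a point form a
quadrangle. -/
theorem IsPartialPlane.exists_quadrangle (h : G.IsPartialPlane) {p a b c d : G.Point}
    {l m : G.Line} (hlm : l ≠ m) (hpl : G.Inc p l) (hpm : G.Inc p m) (hal : G.Inc a l)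
    (hbl : G.Inc b l) (hcm : G.Inc c m) (hdm : G.Inc d m) (hap : a ≠ p) (hbp : b ≠ p) (hab : a ≠ b)
    (hcp : c ≠ p) (hdp : d ≠ p) (hcd : c ≠ d) :
    ∃ x : Fin 4 → G.Point, Function.Injective x ∧
      ∀ i j k : Fin 4, i ≠ j → i ≠ k → j ≠ k →
        ¬ ∃ l : G.Line, G.Inc (x i) l ∧ G.Inc (x j) l ∧ G.Inc (x k) l := by
  -- The only point that the two lines share is `p`.
  have hl : ∀ x, x ≠ p → G.Inc x l → ¬ G.Inc x m := fun x hx h₁ h₂ =>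
    (h x p l m h₁ hpl h₂ hpm).elim hx hlm
  have key₁ : ∀ z, z ≠ p → G.Inc z m → ∀ k, G.Inc a k → G.Inc b k → ¬ G.Inc z k := by
    intro z hz hzm k ha hb hzk
    obtain rfl := (h a b l k hal hbl ha hb).resolve_left hab
    exact hl z hz hzk hzm
  have key₂ : ∀ z, z ≠ p → G.Inc z l → ∀ k, G.Inc c k → G.Inc d k → ¬ G.Inc z k := by
    intro z hz hzl k hc hd hzk
    obtain rfl := (h c d m k hcm hdm hc hd).resolve_left hcd
    exact hl z hz hzl hzk
  have k₁ := key₁ c hcp hcm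
  have k₂ := key₁ d hdp hdm
  have k₃ := key₂ a hap hal
  have k₄ := key₂ b hbp hbl
  have hac : a ≠ c := fun e => hl a hap hal (e ▸ hcm)
  have had : a ≠ d := fun e => hl a hap hal (e ▸ hdm)
  have hbc : b ≠ c := fun e => hl b hbp hbl (e ▸ hcm)
  have hbd : b ≠ d := fun e => hl b hbp hbl (e ▸ hdm)
  clear h hl key₁ key₂ hal hbl hcm hdm hpl hpm
  refine ⟨![a, b, c, d], ?_, ?_⟩
  · intro i j hij
    fin_cases i <;> fin_cases j <;> simp at hij ⊢ <;> grind
  · intro i j k hij hik hjk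
    fin_cases i <;> fin_cases j <;> fin_cases k <;> simp at hij hik hjk ⊢ <;> grind

theorem isProjectivePlane_freeCompletion [hne : Nonempty G.Point] (hG : G.IsPartialPlane)
    (hc : G.IsConfined) : G.freeCompletion.IsProjectivePlane where
  existsUnique_line p q h :=
    existsUnique_of_exists_of_unique (exists_line p q h) fun _ _ h₁ h₂ =>
      (hG.freeCompletion p q _ _ h₁.1 h₁.2 h₂.1 h₂.2).resolve_left h
  existsUnique_point l m h :=
    existsUnique_of_exists_of_unique (exists_point l m h) fun _ _ h₁ h₂ =>
      (hG.freeCompletion _ _ l m h₁.1 h₂.1 h₁.2 h₂.2).resolve_right h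
  exists_quadrangle := by
    obtain ⟨p⟩ := hne
    have hp := exists_mem_ne_ne (hc.three_le_lines p)
    obtain ⟨l, hpl⟩ : ∃ l, G.Inc p l :=
      (Set.encard_pos.1 ((by decide : (0 : ℕ∞) < 3).trans_le (hc.three_le_lines p)))
    obtain ⟨m, hpm, hml, -⟩ := hp l l
    obtain ⟨a, hal, hap, -⟩ := exists_mem_ne_ne (hc.three_le_points l) p p
    obtain ⟨b, hbl, hbp, hba⟩ := exists_mem_ne_ne (hc.three_le_points l) p a
    obtain ⟨c, hcm, hcp, -⟩ := exists_mem_ne_ne (hc.three_le_points m) p p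
    obtain ⟨d, hdm, hdp, hdc⟩ := exists_mem_ne_ne (hc.three_le_points m) p c
    have hP := G.ofPoint_injective 0
    have hI : ∀ {p : G.Point} {l : G.Line}, G.Inc p l →
      G.freeCompletion.Inc (G.ofPoint 0 p) (G.ofLine 0 l) := fun h => inc_of_iff.2 h
    exact hG.freeCompletion.exists_quadrangle ((G.ofLine_injective 0).ne hml.symm) (hI hpl)
      (hI hpm) (hI hal) (hI hbl) (hI hcm) (hI hdm) (hP.ne hap) (hP.ne hbp) (hP.ne hba.symm)
      (hP.ne hcp) (hP.ne hdp) (hP.ne hdc.symm)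

/-! ### Rigidity of the free completion -/

/-- A set of points and a set of lines are thick if every line of the latter is incident with at
least three points of the former, and vice versa. That there are at least three is expressed by
saying that any two can be avoided. -/
structure IsThick (G : PointLineGeometry.{u}) (P : Set G.Point) (L : Set G.Line) : Prop where
  exists_line : ∀ p ∈ P, ∀ a b, ∃ l ∈ L, G.Inc p l ∧ l ≠ a ∧ l ≠ b
  exists_point : ∀ l ∈ L, ∀ a b, ∃ p ∈ P, G.Inc p l ∧ p ≠ a ∧ p ≠ b

/-- A thick subconfiguration of the free completion that lies in some stage lies in the original
geometry, since an element of a later stage has only two neighbours when it is added. -/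
theorem IsThick.subset_zero {P : Set G.freeCompletion.Point} {L : Set G.freeCompletion.Line}
    (h : G.freeCompletion.IsThick P L) {n : ℕ} (hP : P ⊆ Set.range (G.ofPoint n))
    (hL : L ⊆ Set.range (G.ofLine n)) :
    P ⊆ Set.range (G.ofPoint 0) ∧ L ⊆ Set.range (G.ofLine 0) := by
  induction n with
  | zero => exact ⟨hP, hL⟩
  | succ n ih =>
    -- The lines come first: a new line may contain new points, but not conversely.
    have hL' : L ⊆ Set.range (G.ofLine n) := by
      intro l hl
      obtain ⟨l, rfl⟩ := hL hl
      obtain ⟨l, rfl⟩ | ⟨a, b, -, hab⟩ := exists_stage_line_cases n l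
      · exact ⟨l, (ofLine_stageLine n l).symm⟩
      · obtain ⟨p, hp, hpl, ha, hb⟩ := h.exists_point _ hl (G.ofPoint _ a) (G.ofPoint _ b)
        obtain ⟨p, rfl⟩ := hP hp
        obtain rfl | rfl := (hab p).1 (inc_of_iff.1 hpl)
        · exact absurd rfl ha
        · exact absurd rfl hb
    refine ih (fun p hp => ?_) hL'
    obtain ⟨p, rfl⟩ := hP hp
    obtain ⟨p, rfl⟩ | ⟨a, b, -, hab⟩ := exists_stage_point_cases n p
    · exact ⟨p, (ofPoint_stagePoint n p).symm⟩
    · obtain ⟨l, hl, hpl, ha, hb⟩ := h.exists_line _ hp (G.ofLine _ a) (G.ofLine _ b)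
      obtain ⟨l, rfl⟩ := hL' hl
      rw [← ofLine_stageLine, inc_of_iff] at hpl
      obtain rfl | rfl := (hab l).1 hpl
      · exact absurd rfl ha
      · exact absurd rfl hb

/-- The image of a confined geometry under an automorphism of its free completion is thick. -/
theorem IsConfined.isThick_range (hc : G.IsConfined)
    {α : Equiv.Perm G.freeCompletion.Point × Equiv.Perm G.freeCompletion.Line}
    (hα : α ∈ G.freeCompletion.Aut) :
    G.freeCompletion.IsThick (Set.range fun p : G.Point => α.1 (G.ofPoint 0 p))
      (Set.range fun l : G.Line => α.2 (G.ofLine 0 l)) where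
  exists_line := by
    rintro _ ⟨p, rfl⟩ a b
    have hcard := (hc.three_le_lines p).trans_eq
      ((α.2.injective.comp (G.ofLine_injective 0)).encard_image _).symm
    obtain ⟨_, ⟨l, hl, rfl⟩, hla, hlb⟩ := exists_mem_ne_ne hcard a b
    exact ⟨_, ⟨l, rfl⟩, (hα _ _).2 (inc_of_iff.2 hl), hla, hlb⟩
  exists_point := by
    rintro _ ⟨l, rfl⟩ a b
    have hcard := (hc.three_le_points l).trans_eq
      ((α.1.injective.comp (G.ofPoint_injective 0)).encard_image _).symm
    obtain ⟨_, ⟨p, hp, rfl⟩, hpa, hpb⟩ := exists_mem_ne_ne hcard a b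
    exact ⟨_, ⟨p, rfl⟩, (hα _ _).2 (inc_of_iff.2 hp), hpa, hpb⟩

theorem IsConfined.apply_mem_range (hc : G.IsConfined)
    {α : Equiv.Perm G.freeCompletion.Point × Equiv.Perm G.freeCompletion.Line}
    (hα : α ∈ G.freeCompletion.Aut) :
    (∀ p : G.Point, α.1 (G.ofPoint 0 p) ∈ Set.range (G.ofPoint 0)) ∧
      ∀ l : G.Line, α.2 (G.ofLine 0 l) ∈ Set.range (G.ofLine 0) := by
  have := hc.finite_point
  have := hc.finite_line
  obtain ⟨n₁, h₁⟩ := exists_forall_mem_range_ofPoint fun p : G.Point => α.1 (G.ofPoint 0 p)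
  obtain ⟨n₂, h₂⟩ := exists_forall_mem_range_ofLine fun l : G.Line => α.2 (G.ofLine 0 l)
  have h := (hc.isThick_range hα).subset_zero (n := max n₁ n₂)
    (Set.range_subset_iff.2 fun p => range_ofPoint_mono (le_max_left _ _) (h₁ p))
    (Set.range_subset_iff.2 fun l => range_ofLine_mono (le_max_right _ _) (h₂ l))
  exact ⟨Set.range_subset_iff.1 h.1, Set.range_subset_iff.1 h.2⟩

/-- An automorphism of the free completion that fixes the original geometry elementwise is
trivial. -/
theorem eq_of_fixes_zero (hG : G.IsPartialPlane)
    {α : Equiv.Perm G.freeCompletion.Point × Equiv.Perm G.freeCompletion.Line}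
    (hα : α ∈ G.freeCompletion.Aut) (hP : ∀ p : G.Point, α.1 (G.ofPoint 0 p) = G.ofPoint 0 p)
    (hL : ∀ l : G.Line, α.2 (G.ofLine 0 l) = G.ofLine 0 l) : α = 1 := by
  have key : ∀ n, (∀ p, α.1 (G.ofPoint n p) = G.ofPoint n p) ∧
      ∀ l, α.2 (G.ofLine n l) = G.ofLine n l := by
    intro n
    induction n with
    | zero => exact ⟨hP, hL⟩
    | succ n ih =>
      have hP' : ∀ p, α.1 (G.ofPoint (n + 1) p) = G.ofPoint (n + 1) p := by
        intro p
        obtain ⟨p, rfl⟩ | ⟨a, b, hne, hab⟩ := exists_stage_point_cases n p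
        · rw [ofPoint_stagePoint, ih.1]
        · have ha := inc_of_iff.2 ((hab a).2 (Or.inl rfl))
          have hb := inc_of_iff.2 ((hab b).2 (Or.inr rfl))
          rw [ofLine_stageLine] at ha hb
          have ha' := (hα _ _).2 ha
          have hb' := (hα _ _).2 hb
          rw [ih.2] at ha' hb'
          exact (hG.freeCompletion _ _ _ _ ha' ha hb' hb).resolve_right
            ((G.ofLine_injective n).ne hne)
      refine ⟨hP', fun l => ?_⟩
      obtain ⟨l, rfl⟩ | ⟨a, b, hne, hab⟩ := exists_stage_line_cases n l
      · rw [ofLine_stageLine, ih.2]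
      · have ha := inc_of_iff.2 ((hab a).2 (Or.inl rfl))
        have hb := inc_of_iff.2 ((hab b).2 (Or.inr rfl))
        have ha' := (hα _ _).2 ha
        have hb' := (hα _ _).2 hb
        rw [hP'] at ha' hb'
        exact (hG.freeCompletion _ _ _ _ ha' hb' ha hb).resolve_left
          ((G.ofPoint_injective _).ne hne)
  refine Prod.ext (Equiv.ext fun p => ?_) (Equiv.ext fun l => ?_)
  · obtain ⟨n, p, rfl⟩ := exists_mem_range_ofPoint p
    exact (key n).1 p
  · obtain ⟨n, l, rfl⟩ := exists_mem_range_ofLine l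
    exact (key n).2 l

theorem isRigid_freeCompletion (hG : G.IsPartialPlane) (hc : G.IsConfined) (hr : G.IsRigid) :
    G.freeCompletion.IsRigid := by
  refine (Subgroup.eq_bot_iff_forall _).2 fun α hα => ?_
  have := hc.finite_point
  have := hc.finite_line
  -- The restriction of the automorphism to the original geometry, a permutation by finiteness.
  choose σ hσ using (hc.apply_mem_range hα).1
  choose τ hτ using (hc.apply_mem_range hα).2
  have hσi : Function.Injective σ := fun p q e =>
    G.ofPoint_injective 0 (α.1.injective (by rw [← hσ, ← hσ, e]))
  have hτi : Function.Injective τ := fun l m e =>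
    G.ofLine_injective 0 (α.2.injective (by rw [← hτ, ← hτ, e]))
  let β : Equiv.Perm G.Point × Equiv.Perm G.Line :=
    ⟨Equiv.ofBijective σ (Finite.injective_iff_bijective.1 hσi),
      Equiv.ofBijective τ (Finite.injective_iff_bijective.1 hτi)⟩
  have hβ : β ∈ G.Aut := by
    intro p l
    change (G.stage 0).Inc (σ p) (τ l) ↔ (G.stage 0).Inc p l
    have h := hα (G.ofPoint 0 p) (G.ofLine 0 l)
    rw [← hσ, ← hτ] at h
    exact inc_of_iff.symm.trans (h.trans inc_of_iff)
  have hβ1 : β = 1 := (Subgroup.eq_bot_iff_forall _).1 hr β hβ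
  refine eq_of_fixes_zero hG hα (fun p => ?_) fun l => ?_
  · rw [← hσ p]
    exact congrArg (G.ofPoint 0) (DFunLike.congr_fun (congrArg Prod.fst hβ1) p)
  · rw [← hτ l]
    exact congrArg (G.ofLine 0) (DFunLike.congr_fun (congrArg Prod.snd hβ1) l)

/-! ### Complements of automorphism-blocking sets -/

/-- A permutation that extends a permutation of the complement of a set stabilizes the set. -/
theorem apply_mem_iff_of_extends {α : Type*} {s : Set α} (a : Equiv.Perm α)
    (b : Equiv.Perm {x // x ∉ s}) (h : ∀ x, a x.1 = (b x).1) (x : α) : a x ∈ s ↔ x ∈ s := by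
  refine ⟨fun hx => ?_, fun hx => ?_⟩
  · by_contra hxs
    exact (b ⟨x, hxs⟩).2 (h ⟨x, hxs⟩ ▸ hx)
  · by_contra has
    have e : a (b.symm ⟨a x, has⟩).1 = a x := by rw [h, Equiv.apply_symm_apply]
    exact (b.symm ⟨a x, has⟩).2 ((a.injective e).symm ▸ hx)

theorem IsABSet.isRigid_delete {C : G.Subconfig} (h : G.IsABSet C) : (G.delete C).IsRigid := by
  refine (Subgroup.eq_bot_iff_forall _).2 fun b hb => ?_
  obtain ⟨a, ha, hP, hL⟩ := h.ab1 b hb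
  have hs : a ∈ G.stabilizer C :=
    ⟨ha, apply_mem_iff_of_extends a.1 b.1 hP, apply_mem_iff_of_extends a.2 b.2 hL⟩
  rw [h.ab3, h.ab2, Subgroup.mem_bot] at hs
  subst hs
  exact Prod.ext (Equiv.ext fun p => Subtype.ext (hP p).symm)
    (Equiv.ext fun l => Subtype.ext (hL l).symm)

end PointLineGeometry

theorem mainTheorem5 :
    (∀ C₀ : PointLineGeometry.{u},
      Nonempty C₀.Point → C₀.IsPartialPlane → C₀.IsConfined → C₀.IsRigid →
        C₀.freeCompletion.IsProjectivePlane ∧ C₀.freeCompletion.IsRigid) ∧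
    (∀ (Γ : PointLineGeometry.{u}) (C : Γ.Subconfig),
      Γ.IsABSet C →
      Nonempty (Γ.delete C).Point → (Γ.delete C).IsPartialPlane → (Γ.delete C).IsConfined →
        (Γ.delete C).freeCompletion.IsProjectivePlane ∧
          (Γ.delete C).freeCompletion.IsRigid) :=
  ⟨fun _ _ hG hc hr => ⟨PointLineGeometry.isProjectivePlane_freeCompletion hG hc,
      PointLineGeometry.isRigid_freeCompletion hG hc hr⟩,
    fun _ _ h _ hG hc => ⟨PointLineGeometry.isProjectivePlane_freeCompletion hG hc,
      PointLineGeometry.isRigid_freeCompletion hG hc h.isRigid_delete⟩⟩
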